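/- For $x>0$ let $\pi(x)$ denote the number of primes not exceeding $x$, and let $F_0=0$, $F_1=1$ and $F_{k+1}=F_k+F_{k-1}$ $(k=1,2,3,\ldots)$ be the Fibonacci numbers. For every integer $m>3$ there is a positive integer $n$ such that $$\pi(mn)=F_m+n.$$ -/

import Mathlib

/-! Let f(N) = m π(N) − N. Passing from N to N + 1 lowers f by at most 1, and π(x) = o(x) makes f
eventually smaller than m F_m. So once f(N) ≥ m F_m for some N, f takes the value m F_m exactly;
there m divides N, and N = mn gives π(mn) = F_m + n.

Such an N exists near 2^m for m ≥ 15: Chebyshev's quotient (30n)! n! / ((15n)! (10n)! (6n)!) bounds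
π from below (`mul_primeCounting_thirty_mul_ge`), and m F_m is small against 2^m
(`mul_fib_add_two_le`). For 4 ≤ m ≤ 14 explicit prime counts suffice. -/

lemma exists_primeCounting_mul_eq {m F N : ℕ} (hm : 2 ≤ m) (hF : 0 < F)
    (h : N + m * F ≤ m * Nat.primeCounting N) :
    ∃ n : ℕ, 0 < n ∧ Nat.primeCounting (m * n) = F + n := by
  have hex : ∃ K, m * Nat.primeCounting (N + K) < N + K + m * F := by
    -- Chebyshev's bound π(x) ≤ (log 4 + 1) x / log x gives m π(x) < x once log x exceeds this
    -- constant.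
    have hlog := Real.tendsto_log_atTop.eventually_gt_atTop ((Real.log 4 + 1) * m)
    have hev := (tendsto_natCast_atTop_atTop (R := ℝ)).eventually
      ((Chebyshev.eventually_primeCounting_le one_pos).and hlog)
    obtain ⟨x, ⟨hpi, hl⟩, hx⟩ := (hev.and (Filter.eventually_ge_atTop (N + 1))).exists
    refine ⟨x - N, ?_⟩
    rw [Nat.add_sub_cancel' (by omega)]
    rw [Nat.floor_natCast] at hpi
    have hm0 : (0 : ℝ) < m := by positivity
    have hl0 : 0 < Real.log x := lt_of_le_of_lt (by positivity) hl
    have hx0 : (0 : ℝ) < x := by exact_mod_cast (by omega : 0 < x)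
    rw [le_div_iff₀ hl0] at hpi
    have h1 : (m * Nat.primeCounting x : ℝ) * Real.log x < x * Real.log x := by
      calc (m * Nat.primeCounting x : ℝ) * Real.log x
          = m * (Nat.primeCounting x * Real.log x) := by ring
        _ ≤ m * ((Real.log 4 + 1) * x) := by gcongr
        _ = x * ((Real.log 4 + 1) * m) := by ring
        _ < x * Real.log x := by gcongr
    have h2 : m * Nat.primeCounting x < x := by exact_mod_cast lt_of_mul_lt_mul_right h1 hl0.le
    omega
  classical
  obtain ⟨K, hK⟩ : ∃ K, Nat.find hex = K + 1 :=
    Nat.exists_eq_succ_of_ne_zero fun h0 => by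
      have := Nat.find_spec hex
      rw [h0] at this
      simp only [add_zero] at this
      omega
  have hmin := Nat.find_min hex (m := K) (by omega)
  have hspec := Nat.find_spec hex
  rw [hK] at hspec
  have hmono : Nat.primeCounting (N + K) ≤ Nat.primeCounting (N + (K + 1)) :=
    Nat.monotone_primeCounting (by omega)
  have hmono' := Nat.mul_le_mul_left m hmono
  -- K is the last index before the first drop below m F; as a drop is at most 1, equality holds at
  -- K.
  have heq : m * Nat.primeCounting (N + K) = N + K + m * F := by omega
  have hFle : F ≤ Nat.primeCounting (N + K) :=
    Nat.le_of_mul_le_mul_left (by omega : m * F ≤ m * _) (by omega)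
  obtain ⟨n, hn⟩ := Nat.exists_eq_add_of_le hFle
  have hmn : m * n = N + K := by
    rw [hn, mul_add] at heq
    omega
  refine ⟨n, Nat.pos_of_ne_zero fun h0 => ?_, by rw [hmn, hn]⟩
  rw [h0, mul_zero] at hmn
  rw [← hmn, Nat.primeCounting_zero] at hFle
  omega

/-- Sum log = Λ * ζ over k ≤ n. Terms with k > n vanish, so a common range N lets several factorials
be compared termwise. -/
lemma log_factorial_eq_sum_vonMangoldt {n N : ℕ} (hn : n ≤ N) :
    Real.log n.factorial = ∑ k ∈ Finset.Ioc 0 N,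
      ArithmeticFunction.vonMangoldt k * (n / k : ℕ) := by
  have h := ArithmeticFunction.sum_Ioc_mul_zeta_eq_sum (R := ℝ) ArithmeticFunction.vonMangoldt n
  rw [ArithmeticFunction.vonMangoldt_mul_zeta] at h
  rw [← Finset.sum_subset (Finset.Ioc_subset_Ioc_right hn), ← h]
  · simp_rw [ArithmeticFunction.log_apply]
    clear h
    induction n with
    | zero => simp
    | succ n ih =>
      rw [Nat.factorial_succ, Nat.cast_mul, Real.log_mul (by positivity) (by positivity),
        ← Finset.insert_Ioc_right_eq_Ioc_add_one (Nat.zero_le n), Finset.sum_insert (by simp),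
        ih (by omega)]
  · intro k hk hk'
    simp only [Finset.mem_Ioc, not_and, not_le] at hk hk'
    simp [Nat.div_eq_of_lt (hk' hk.1)]

/-- The Stirling sequence decreases, so its value at 1 bounds it; that is where the constant 1 comes
from. -/
lemma log_factorial_le {n : ℕ} (hn : n ≠ 0) :
    Real.log n.factorial ≤ n * Real.log n - n + Real.log n / 2 + 1 := by
  obtain ⟨k, rfl⟩ := Nat.exists_eq_succ_of_ne_zero hn
  have h := Stirling.log_stirlingSeq'_antitone (Nat.zero_le k)
  simp only [Function.comp_apply, Stirling.log_stirlingSeq_formula] at h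
  have hk : ((k.succ : ℕ) : ℝ) ≠ 0 := by positivity
  rw [Real.log_div hk (Real.exp_ne_zero 1), Real.log_exp, Real.log_mul two_ne_zero hk] at h
  simp at h ⊢
  linarith

/-- All the floors are functions of q = ⌊30n/k⌋. Since 1 + 1/30 = 1/2 + 1/3 + 1/5, the claim depends
only on q mod 30. -/
lemma chebyshev_floor_le (n k : ℕ) :
    30 * n / k + n / k ≤ 15 * n / k + 10 * n / k + 6 * n / k + 1 := by
  have h2 : 15 * n / k = 30 * n / k / 2 := by
    rw [Nat.div_div_eq_div_mul, mul_comm k, show 30 * n = 2 * (15 * n) by ring,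
      Nat.mul_div_mul_left _ _ two_pos]
  have h3 : 10 * n / k = 30 * n / k / 3 := by
    rw [Nat.div_div_eq_div_mul, mul_comm k, show 30 * n = 3 * (10 * n) by ring,
      Nat.mul_div_mul_left _ _ three_pos]
  have h5 : 6 * n / k = 30 * n / k / 5 := by
    rw [Nat.div_div_eq_div_mul, mul_comm k, show 30 * n = 5 * (6 * n) by ring,
      Nat.mul_div_mul_left _ _ (by norm_num)]
  have h30 : n / k = 30 * n / k / 30 := by
    rw [Nat.div_div_eq_div_mul, mul_comm k, Nat.mul_div_mul_left _ _ (by norm_num)]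
  omega

lemma chebyshev_factorial_le_psi (n : ℕ) :
    Real.log (30 * n).factorial + Real.log n.factorial ≤
      Real.log (15 * n).factorial + Real.log (10 * n).factorial + Real.log (6 * n).factorial
        + Chebyshev.psi (30 * n : ℕ) := by
  rw [log_factorial_eq_sum_vonMangoldt (le_refl (30 * n)),
    log_factorial_eq_sum_vonMangoldt (by omega : n ≤ 30 * n),
    log_factorial_eq_sum_vonMangoldt (by omega : 15 * n ≤ 30 * n),
    log_factorial_eq_sum_vonMangoldt (by omega : 10 * n ≤ 30 * n),
    log_factorial_eq_sum_vonMangoldt (by omega : 6 * n ≤ 30 * n), Chebyshev.psi,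
    Nat.floor_natCast]
  simp_rw [← Finset.sum_add_distrib]
  refine Finset.sum_le_sum fun k _ => ?_
  have h : ((30 * n / k : ℕ) : ℝ) + (n / k : ℕ) ≤
      (15 * n / k : ℕ) + (10 * n / k : ℕ) + (6 * n / k : ℕ) + 1 := by
    exact_mod_cast chebyshev_floor_le n k
  have := mul_le_mul_of_nonneg_left h (ArithmeticFunction.vonMangoldt_nonneg (n := k))
  linarith

/-- In Stirling's estimates the linear terms cancel (30 + 1 = 15 + 10 + 6), leaving the main term n
(14 log 2 + 9 log 3 + 5 log 5) ≥ 39 n log 2. The error is at most log(30n)/2 + 3, which the summand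
2 absorbs. -/
lemma mul_primeCounting_thirty_mul_ge {n m : ℕ} (hn : n ≠ 0) (hm : 30 * n ≤ 2 ^ m) :
    39 * n ≤ m * (Nat.primeCounting (30 * n) + 2) := by
  have h := chebyshev_factorial_le_psi n
  have hpsi := Chebyshev.psi_le_primeCounting_mul_log (30 * n)
  have l1 := Stirling.le_log_factorial_stirling (n := 30 * n) (by omega)
  have l2 := Stirling.le_log_factorial_stirling hn
  have u1 := log_factorial_le (n := 15 * n) (by omega)
  have u2 := log_factorial_le (n := 10 * n) (by omega)
  have u3 := log_factorial_le (n := 6 * n) (by omega)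
  have hpi : 0 ≤ Real.log (2 * Real.pi) := Real.log_nonneg (by linarith [Real.pi_gt_three])
  have hn1 : (1 : ℝ) ≤ n := by exact_mod_cast Nat.one_le_iff_ne_zero.2 hn
  have hlogn : 0 ≤ Real.log n := Real.log_nonneg hn1
  have hn0 : (n : ℝ) ≠ 0 := by positivity
  have e30 : Real.log 30 = Real.log 2 + Real.log 3 + Real.log 5 := by
    rw [← Real.log_mul, ← Real.log_mul] <;> norm_num
  have e15 : Real.log 15 = Real.log 3 + Real.log 5 := by rw [← Real.log_mul] <;> norm_num
  have e10 : Real.log 10 = Real.log 2 + Real.log 5 := by rw [← Real.log_mul] <;> norm_num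
  have e6 : Real.log 6 = Real.log 2 + Real.log 3 := by rw [← Real.log_mul] <;> norm_num
  have hK : 39 * Real.log 2 ≤ 14 * Real.log 2 + 9 * Real.log 3 + 5 * Real.log 5 := by
    have : Real.log ((2 : ℝ) ^ 25) ≤ Real.log ((3 : ℝ) ^ 9 * 5 ^ 5) :=
      Real.log_le_log (by positivity) (by norm_num)
    rw [Real.log_mul (by positivity) (by positivity), Real.log_pow, Real.log_pow,
      Real.log_pow] at this
    push_cast at this
    linarith
  -- Gives 3 ≤ (3/2) log(30n), so the error is at most 2 log(30n).
  have h2 : 2 ≤ Real.log 30 := by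
    rw [Real.le_log_iff_exp_le (by norm_num)]
    have := Real.exp_one_lt_d9
    calc Real.exp 2 = Real.exp 1 ^ 2 := by rw [← Real.exp_nat_mul]; norm_num
      _ ≤ 3 ^ 2 := by gcongr; linarith
      _ ≤ 30 := by norm_num
  have hmlog : Real.log (30 * n : ℕ) ≤ m * Real.log 2 := by
    rw [← Real.log_pow]
    exact Real.log_le_log (by positivity) (by exact_mod_cast hm)
  have hKn := mul_le_mul_of_nonneg_left hK (by positivity : (0 : ℝ) ≤ n)
  have hmain : 39 * n * Real.log 2 ≤
      (Nat.primeCounting (30 * n) + 2 : ℝ) * Real.log (30 * n : ℕ) := by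
    push_cast at *
    rw [Real.log_mul (by norm_num) hn0] at *
    rw [e30] at *
    rw [e15] at u1
    rw [e10] at u2
    rw [e6] at u3
    nlinarith
  have hfin : (39 * n : ℝ) * Real.log 2 ≤
      (m * (Nat.primeCounting (30 * n) + 2)) * Real.log 2 := by
    have := mul_le_mul_of_nonneg_left hmlog
      (by positivity : (0 : ℝ) ≤ Nat.primeCounting (30 * n) + 2)
    linarith
  exact_mod_cast le_of_mul_le_mul_right hfin (Real.log_pos one_lt_two)

/-- Two-step induction: F_m grows more slowly than 2^m, and the factor m costs at most 17/15 and
17/16 per step. The form is the one needed for N = 30⌊2^m/30⌋; 87 = 3 · 29 pays for the floor. -/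
lemma mul_fib_add_two_le {m : ℕ} (hm : 15 ≤ m) : 10 * (m * (Nat.fib m + 2)) + 87 ≤ 3 * 2 ^ m := by
  have key : ∀ k, 10 * ((k + 15) * (Nat.fib (k + 15) + 2)) + 87 ≤ 3 * 2 ^ (k + 15) ∧
      10 * ((k + 16) * (Nat.fib (k + 16) + 2)) + 87 ≤ 3 * 2 ^ (k + 16) := by
    intro k
    induction k with
    | zero => norm_num
    | succ k ih =>
      rw [show k + 1 + 15 = k + 16 by rfl, show k + 1 + 16 = k + 17 by rfl]
      refine ⟨ih.2, ?_⟩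
      have hf : Nat.fib (k + 17) = Nat.fib (k + 15) + Nat.fib (k + 16) :=
        Nat.fib_add_two (n := k + 15)
      have hp : 2 ^ (k + 17) = 2 * 2 ^ (k + 16) := by ring
      have hp' : 2 ^ (k + 16) = 2 * 2 ^ (k + 15) := by ring
      have h1 := Nat.mul_le_mul_right (Nat.fib (k + 15) + 2)
        (by linarith : 15 * (k + 17) ≤ 17 * (k + 15))
      have h2 := Nat.mul_le_mul_right (Nat.fib (k + 16) + 2)
        (by linarith : 16 * (k + 17) ≤ 17 * (k + 16))
      have i1 := ih.1
      have i2 := ih.2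
      have hs : (k + 17) * (Nat.fib (k + 17) + 2) + 2 * (k + 17) =
          (k + 17) * (Nat.fib (k + 15) + 2) + (k + 17) * (Nat.fib (k + 16) + 2) := by
        rw [hf]; ring
      nlinarith only [i1, i2, h1, h2, hs, hp, hp']
  obtain ⟨k, rfl⟩ := Nat.exists_eq_add_of_le' hm
  exact (key k).1

/-- Primality test for `2 ≤ n < (b + 1) ^ 2`: coprimality to all positive integers below `n` and
up to `b`. -/
def coprimeFactorialTest (b n : ℕ) : Bool :=
  Nat.ble 2 n && Nat.beq (Nat.gcd n (min (n - 1) b).factorial) 1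

/-- A composite n has a prime factor at most √n, hence at most b and below n, which divides the
factorial. -/
lemma prime_of_coprimeFactorialTest {b n : ℕ} (hn : n < (b + 1) ^ 2)
    (h : coprimeFactorialTest b n = true) : n.Prime := by
  simp only [coprimeFactorialTest, Bool.and_eq_true, Nat.ble_eq, Nat.beq_eq] at h
  obtain ⟨h2, hg⟩ := h
  by_contra hp
  have hne : n ≠ 1 := by omega
  have hle : n.minFac ^ 2 ≤ n := Nat.minFac_sq_le_self (by omega) hp
  have hlt : n.minFac < n := (Nat.not_prime_iff_minFac_lt h2).1 hp
  have hb : n.minFac < b + 1 := lt_of_pow_lt_pow_left₀ 2 (by omega) (hle.trans_lt hn)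
  have hd : n.minFac ∣ (min (n - 1) b).factorial :=
    (Nat.minFac_prime hne).dvd_factorial.2 (by omega)
  have : n.minFac ∣ 1 := hg ▸ Nat.dvd_gcd n.minFac_dvd hd
  exact (Nat.minFac_prime hne).one_lt.ne' (Nat.dvd_one.1 this)

lemma count_coprimeFactorialTest_le (b s k : ℕ) (h : s + k ≤ (b + 1) ^ 2) :
    Nat.primeCounting' s + Nat.count (fun i => coprimeFactorialTest b (s + i) = true) k
      ≤ Nat.primeCounting' (s + k) := by
  unfold Nat.primeCounting'
  rw [Nat.count_add]
  gcongr with i hi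
  exact prime_of_coprimeFactorialTest (by omega)

/-- Lets a count be accumulated over short intervals; 6400 = (79 + 1)^2 is the range where the test
with b = 79 is valid. -/
lemma le_primeCounting'_of_count {s k p c : ℕ} (hs : p ≤ Nat.primeCounting' s)
    (hk : s + k ≤ 6400)
    (hc : c ≤ Nat.count (fun i => coprimeFactorialTest 79 (s + i) = true) k) :
    p + c ≤ Nat.primeCounting' (s + k) :=
  (add_le_add hs hc).trans (count_coprimeFactorialTest_le 79 s k hk)

lemma exists_primeCounting_ge_of_le_fourteen {m : ℕ} (hm : 3 < m) (hm' : m ≤ 14) :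
    ∃ N, N + m * Nat.fib m ≤ m * Nat.primeCounting N := by
  have h0 : 0 ≤ Nat.primeCounting' 0 := Nat.zero_le _
  -- `Nat.primeCounting'` counts primes strictly below its argument, so the witness N below uses the
  -- bound at N + 1. Some endpoints only subdivide long intervals.
  have h21 : 8 ≤ Nat.primeCounting' 21 :=
    le_primeCounting'_of_count (k := 21) (c := 8) h0 (by norm_num)
      (by decide +kernel)
  have h46 : 14 ≤ Nat.primeCounting' 46 :=
    le_primeCounting'_of_count (k := 25) (c := 6) h21 (by norm_num)
      (by decide +kernel)
  have h73 : 20 ≤ Nat.primeCounting' 73 :=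
    le_primeCounting'_of_count (k := 27) (c := 6) h46 (by norm_num)
      (by decide +kernel)
  have h113 : 29 ≤ Nat.primeCounting' 113 :=
    le_primeCounting'_of_count (k := 40) (c := 9) h73 (by norm_num)
      (by decide +kernel)
  have h201 : 46 ≤ Nat.primeCounting' 201 :=
    le_primeCounting'_of_count (k := 88) (c := 17) h113 (by norm_num)
      (by decide +kernel)
  have h406 : 79 ≤ Nat.primeCounting' 406 :=
    le_primeCounting'_of_count (k := 205) (c := 33) h201 (by norm_num)
      (by decide +kernel)
  have h681 : 123 ≤ Nat.primeCounting' 681 :=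
    le_primeCounting'_of_count (k := 275) (c := 44) h406 (by norm_num)
      (by decide +kernel)
  have h1277 : 205 ≤ Nat.primeCounting' 1277 :=
    le_primeCounting'_of_count (k := 596) (c := 82) h681 (by norm_num)
      (by decide +kernel)
  have h1736 : 270 ≤ Nat.primeCounting' 1736 :=
    le_primeCounting'_of_count (k := 459) (c := 65) h1277 (by norm_num)
      (by decide +kernel)
  have h2197 : 327 ≤ Nat.primeCounting' 2197 :=
    le_primeCounting'_of_count (k := 461) (c := 57) h1736 (by norm_num)
      (by decide +kernel)
  have h2708 : 394 ≤ Nat.primeCounting' 2708 :=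
    le_primeCounting'_of_count (k := 511) (c := 67) h2197 (by norm_num)
      (by decide +kernel)
  have h3220 : 455 ≤ Nat.primeCounting' 3220 :=
    le_primeCounting'_of_count (k := 512) (c := 61) h2708 (by norm_num)
      (by decide +kernel)
  have h3732 : 520 ≤ Nat.primeCounting' 3732 :=
    le_primeCounting'_of_count (k := 512) (c := 65) h3220 (by norm_num)
      (by decide +kernel)
  have h4265 : 585 ≤ Nat.primeCounting' 4265 :=
    le_primeCounting'_of_count (k := 533) (c := 65) h3732 (by norm_num)
      (by decide +kernel)
  have h4798 : 645 ≤ Nat.primeCounting' 4798 :=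
    le_primeCounting'_of_count (k := 533) (c := 60) h4265 (by norm_num)
      (by decide +kernel)
  have h5332 : 705 ≤ Nat.primeCounting' 5332 :=
    le_primeCounting'_of_count (k := 534) (c := 60) h4798 (by norm_num)
      (by decide +kernel)
  have h5866 : 771 ≤ Nat.primeCounting' 5866 :=
    le_primeCounting'_of_count (k := 534) (c := 66) h5332 (by norm_num)
      (by decide +kernel)
  have h6399 : 834 ≤ Nat.primeCounting' 6399 :=
    le_primeCounting'_of_count (k := 533) (c := 63) h5866 (by norm_num)
      (by decide +kernel)
  interval_cases m
  -- In each case the count just recorded meets the requirement with equality: here 20 + 4 · 3 = 4 ·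
  -- 8.
  · exact ⟨20, by rw [Nat.primeCounting_eq_primeCounting'_succ]; norm_num; omega⟩
  · exact ⟨45, by rw [Nat.primeCounting_eq_primeCounting'_succ]; norm_num; omega⟩
  · exact ⟨72, by rw [Nat.primeCounting_eq_primeCounting'_succ]; norm_num; omega⟩
  · exact ⟨112, by rw [Nat.primeCounting_eq_primeCounting'_succ]; norm_num; omega⟩
  · exact ⟨200, by rw [Nat.primeCounting_eq_primeCounting'_succ]; norm_num; omega⟩
  · exact ⟨405, by rw [Nat.primeCounting_eq_primeCounting'_succ]; norm_num; omega⟩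
  · exact ⟨680, by rw [Nat.primeCounting_eq_primeCounting'_succ]; norm_num; omega⟩
  · exact ⟨1276, by rw [Nat.primeCounting_eq_primeCounting'_succ]; norm_num; omega⟩
  · exact ⟨2196, by rw [Nat.primeCounting_eq_primeCounting'_succ]; norm_num; omega⟩
  · exact ⟨3731, by rw [Nat.primeCounting_eq_primeCounting'_succ]; norm_num; omega⟩
  · exact ⟨6398, by rw [Nat.primeCounting_eq_primeCounting'_succ]; norm_num; omega⟩

lemma exists_primeCounting_ge_of_fifteen_le {m : ℕ} (hm : 15 ≤ m) :
    ∃ N, N + m * Nat.fib m ≤ m * Nat.primeCounting N := by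
  have hfib := mul_fib_add_two_le hm
  have hpos : 0 < m * (Nat.fib m + 2) := by positivity
  -- With n = ⌊2^m/30⌋ and N = 30n, it suffices that m (F_m + 2) ≤ 39n − 30n = 9n, and 30n ≥ 2^m −
  -- 29.
  have h := mul_primeCounting_thirty_mul_ge (n := 2 ^ m / 30) (m := m) (by omega) (by omega)
  refine ⟨30 * (2 ^ m / 30), ?_⟩
  rw [mul_add] at h hfib
  omega

theorem corollary1p3 (m : ℕ) (hm : 3 < m) :
    ∃ n : ℕ, 0 < n ∧ Nat.primeCounting (m * n) = Nat.fib m + n := by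
  obtain ⟨N, hN⟩ : ∃ N, N + m * Nat.fib m ≤ m * Nat.primeCounting N := by
    rcases Nat.lt_or_ge 14 m with h | h
    · exact exists_primeCounting_ge_of_fifteen_le h
    · exact exists_primeCounting_ge_of_le_fourteen hm h
  exact exists_primeCounting_mul_eq (by omega) (Nat.fib_pos.2 (by omega)) hN
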